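/- Work in $\mathbb R^3$ with lattice $\mathbb Z^3$; $\mathrm{Vol}$ denotes normalized volume ($3!$ times Lebesgue measure). Let $f=\bigoplus_{v} c_v\odot x^{v}$ be a tropical (min-plus) polynomial in three variables, where $c_v\in\mathbb R\cup\{\infty\}$ and only finitely many $c_v$ are finite. Its Newton polytope is $\mathrm{Newt}(f)=\mathrm{conv}\{v: c_v\neq\infty\}$; its tropical surface $T(f)$ is the set of $x\in\mathbb R^3$ at which the minimum of the quantities $c_v+v\cdot x$ is attained at least twice; the regions of $T(f)$ are the closures of the connected components of $\mathbb R^3\setminus T(f)$. The regular subdivision of $\mathrm{Newt}(f)$ induced by $f$ is obtained by projecting the lower faces of the convex hull of the points $(v,c_v)\in\mathbb R^4$. It is a unimodular triangulation if all its maximal cells are tetrahedra of normalized volume $1$, and in this case $T(f)$ is called smooth. A triangulation is central with respect to a lattice point $p$ if the union of each of its simplices with $p$ is again one of its simplices. A K3 polytope is the unique bounded region of a smooth surface $T(f)$ for which all exponents $(i,j,k)$ of $f$ satisfy $i,j,k\ge 0$ and $i+j+k\le 4$. A three-dimensional lattice polytope $P$ with exactly one interior lattice point $p$ is reflexive if $a\cdot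 p-c=1$ for every facet inequality $a\cdot x\ge c$ of $P$ with $a\in\mathbb Z^3$ primitive. Let $4\Delta_3=\mathrm{conv}\{0,4e_1,4e_2,4e_3\}$. **Lemma.** (1) Let $P\subseteq 4\Delta_3$ be a reflexive polytope with interior lattice point $p$, let $\mathcal T$ be a regular unimodular triangulation of $P$ that is central with respect to $p$, and let $f$ be any tropical polynomial with $\mathrm{Newt}(f)=P$ that induces $\mathcal T$. Then $T(f)$ has a unique bounded region $Q$ (the K3 polytope dual to $\mathcal T$); it is a three-dimensional polytope, and its numbers of vertices, edges and facets are $$f_0=\mathrm{Vol}(P),\qquad f_1=\tfrac32\mathrm{Vol}(P),\qquad f_2=\tfrac12\mathrm{Vol}(P)+2 .$$ (2) Every K3 polytope has finitely many vertices, and their number is even. -/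

import Mathlib

namespace K3

noncomputable section

/-- A lattice point of `ℤ³`, seen in `ℝ³`. -/
def toReal (v : Fin 3 → ℤ) : Fin 3 → ℝ := fun i => (v i : ℝ)

/-- Normalized volume of a subset of `ℝ³`: `3!` times the Lebesgue volume. -/
def normalizedVolume (P : Set (Fin 3 → ℝ)) : ℝ :=
  (Nat.factorial 3 : ℝ) * MeasureTheory.volume.real P

/-- The dimension of (the affine hull of) a nonempty subset of `ℝ³`. -/
def dim (F : Set (Fin 3 → ℝ)) : ℕ := Module.finrank ℝ (vectorSpan ℝ F)

/-- A polytope: the convex hull of finitely many points. -/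
def IsPolytope (Q : Set (Fin 3 → ℝ)) : Prop :=
  ∃ S : Finset (Fin 3 → ℝ), Q = convexHull ℝ (S : Set (Fin 3 → ℝ))

/-- The lattice polytope spanned by a finite set of lattice points. -/
def latticeHull (S : Finset (Fin 3 → ℤ)) : Set (Fin 3 → ℝ) :=
  convexHull ℝ (toReal '' (S : Set (Fin 3 → ℤ)))

/-- The `k`-dimensional faces of `Q`: the nonempty subsets of `Q` of dimension `k` on which some
linear functional attains its maximum over `Q`. -/
def faces (Q : Set (Fin 3 → ℝ)) (k : ℕ) : Set (Set (Fin 3 → ℝ)) :=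
  {F | F.Nonempty ∧ IsExposed ℝ Q F ∧ dim F = k}

/-- The entry `f_k` of the f-vector of `Q`: its number of `k`-dimensional faces. -/
def fNumber (Q : Set (Fin 3 → ℝ)) (k : ℕ) : ℕ := (faces Q k).ncard

/-- The fourth dilation `4Δ₃` of the standard tetrahedron. -/
def fourSimplex : Set (Fin 3 → ℝ) :=
  convexHull ℝ {![0, 0, 0], ![4, 0, 0], ![0, 4, 0], ![0, 0, 4]}

/-- An integer vector is primitive if its entries have no common divisor besides units. -/
def IsPrimitive (a : Fin 3 → ℤ) : Prop := ∀ d : ℤ, (∀ i, d ∣ a i) → IsUnit d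

/-- `P` is a three-dimensional reflexive lattice polytope with interior lattice point `p`:
`p` is the only lattice point in the interior of `P`, and whenever `a · x ≥ c` is the inequality of
a facet of `P` with primitive `a`, one has `a · p - c = 1`. -/
structure IsReflexive (P : Set (Fin 3 → ℝ)) (p : Fin 3 → ℤ) : Prop where
  lattice : ∃ S : Finset (Fin 3 → ℤ), P = latticeHull S
  interior_iff : ∀ q : Fin 3 → ℤ, toReal q ∈ interior P ↔ q = p
  facet : ∀ (a : Fin 3 → ℤ) (c : ℤ), IsPrimitive a →
    (∀ x ∈ P, (c : ℝ) ≤ toReal a ⬝ᵥ x) →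
    {x ∈ P | toReal a ⬝ᵥ x = (c : ℝ)}.Nonempty →
    dim {x ∈ P | toReal a ⬝ᵥ x = (c : ℝ)} = 2 →
    a ⬝ᵥ p - c = 1

/-- Tropical (Laurent) polynomials in three variables over `(ℝ ∪ {∞}, min, +)`: families of
coefficients `c_v`, `v ∈ ℤ³`, all but finitely many of them the tropical zero `∞`. -/
abbrev TropPoly : Type := (Fin 3 → ℤ) →₀ Tropical (WithTop ℝ)

namespace TropPoly

/-- The coefficient `c_v ∈ ℝ ∪ {∞}`. -/
def c (f : TropPoly) (v : Fin 3 → ℤ) : WithTop ℝ := Tropical.untrop (f v)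

/-- The value `c_v + v · x` of the monomial with exponent `v` at the point `x`. -/
def term (f : TropPoly) (v : Fin 3 → ℤ) (x : Fin 3 → ℝ) : WithTop ℝ :=
  f.c v + ((toReal v ⬝ᵥ x : ℝ) : WithTop ℝ)

/-- The tropical hypersurface `T(f)`: the points of `ℝ³` at which the minimum of the quantities
`c_v + v · x` is attained at least twice. -/
def hypersurface (f : TropPoly) : Set (Fin 3 → ℝ) :=
  {x | ∃ v w, v ≠ w ∧ f.term v x = f.term w x ∧ ∀ u, f.term v x ≤ f.term u x}

/-- The Newton polytope of `f`; the support of `f` is `{v : c_v ≠ ∞}`. -/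
def newton (f : TropPoly) : Set (Fin 3 → ℝ) := latticeHull f.support

/-- The regular subdivision induced by the coefficients of `f`. Its cells (recorded by the exponents
that they carry) are the projections of the lower faces of the lifted configuration of the points
`(v, c_v)`, that is, the sets of exponents whose lifted points lie on the graph of an affine
function `v ↦ a · v + b` which lies weakly below all lifted points. The empty face is included. -/
def regularSubdivision (f : TropPoly) : Set (Finset (Fin 3 → ℤ)) :=
  {S | ∃ (a : Fin 3 → ℝ) (b : ℝ),
    (∀ v, ((a ⬝ᵥ toReal v + b : ℝ) : WithTop ℝ) ≤ f.c v) ∧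
    ∀ v, v ∈ S ↔ ((a ⬝ᵥ toReal v + b : ℝ) : WithTop ℝ) = f.c v}

/-- The regions of `T(f)`: the closures of the connected components of the complement. -/
def regions (f : TropPoly) : Set (Set (Fin 3 → ℝ)) :=
  {R | ∃ x ∈ (f.hypersurface)ᶜ, R = closure (connectedComponentIn (f.hypersurface)ᶜ x)}

/-- `Q` is the unique bounded region of `T(f)`. -/
def IsBoundedRegion (f : TropPoly) (Q : Set (Fin 3 → ℝ)) : Prop :=
  Q ∈ f.regions ∧ Bornology.IsBounded Q ∧ ∀ R ∈ f.regions, Bornology.IsBounded R → R = Q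

/-- All exponents `(i, j, k)` of `f` satisfy `i, j, k ≥ 0` and `i + j + k ≤ 4`. -/
def IsQuartic (f : TropPoly) : Prop :=
  ∀ v ∈ f.support, (∀ i, 0 ≤ v i) ∧ ∑ i, v i ≤ 4

end TropPoly

/-- A subdivision is a unimodular triangulation if all its maximal cells are tetrahedra (without
further points) of normalized volume one. -/
def IsUnimodularTriangulation (T : Set (Finset (Fin 3 → ℤ))) : Prop :=
  ∀ S, Maximal (· ∈ T) S → S.card = 4 ∧ normalizedVolume (latticeHull S) = 1

/-- The central part (star) of `p` in `T`: the cells whose union with `p` is again a cell. -/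
def centralPart (T : Set (Finset (Fin 3 → ℤ))) (p : Fin 3 → ℤ) : Set (Finset (Fin 3 → ℤ)) :=
  {S ∈ T | insert p S ∈ T}

/-- `T` is central (with respect to `p`) if it coincides with its central part. -/
def IsCentral (T : Set (Finset (Fin 3 → ℤ))) (p : Fin 3 → ℤ) : Prop := centralPart T p = T

/-- `T(f)` is smooth if the regular subdivision induced by `f` is a unimodular triangulation. -/
def TropPoly.IsSmooth (f : TropPoly) : Prop := IsUnimodularTriangulation f.regularSubdivision

/-- `Q` is a K3 polytope: the unique bounded region of some smooth tropical quartic surface. -/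
def IsK3Polytope (Q : Set (Fin 3 → ℝ)) : Prop :=
  ∃ f : TropPoly, f.IsQuartic ∧ f.IsSmooth ∧ f.IsBoundedRegion Q

end

end K3

/-! ### Polyhedra given by linear inequalities, and their active sets -/

namespace Polyhedron

open Module Filter Topology

variable {ι E : Type*} [NormedAddCommGroup E] [NormedSpace ℝ E]

/-! The region of `T(f)` belonging to an exponent `v` is the polyhedron on which the monomial `v` is
minimal, with one inequality for each other exponent. By duality, the inequalities active at its
points form exactly the links of `v` in the regular subdivision (`mem_activeSets_iff`). In a
unimodular triangulation every cell is affinely independent, so the region is a simple polyhedron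
(`IsSmooth.isSimple`), and its faces of dimension `k` are the links with `3 - k` elements.

For a bounded simple polyhedron, a generic functional `l` has a unique top vertex on every face. If
`p B` edges descend from the vertex `B`, the `k`-faces with top `B` are chosen by `k` of these
edges, so `f_k = ∑ (p B).choose k`. The functional `-l` replaces `p` by `3 - p`. Comparing the two
counts gives `2 f₁ = 3 f₀` and Euler's relation, hence `2 f₂ = f₀ + 4`; the first equation also
makes `f₀` even.

For the first part it remains to find `f₀`. Centrality puts `p` in every tetrahedron, so vertices of
the region correspond to tetrahedra. These have normalized volume one, cover the Newton polytope up
to a null set and overlap in null sets (`IsSmooth.normalizedVolume_newton`). The region of an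
interior exponent is bounded, and every bounded region comes from an interior exponent, so `p` gives
the only one. -/

/-- The polyhedron cut out by the inequalities `a i x ≤ b i`, `i ∈ I`. -/
def carrier (I : Finset ι) (a : ι → Dual ℝ E) (b : ι → ℝ) : Set E :=
  {x | ∀ i ∈ I, a i x ≤ b i}

/-- The inequalities that are equalities at `x`. -/
noncomputable def active (I : Finset ι) (a : ι → Dual ℝ E) (b : ι → ℝ) (x : E) : Finset ι :=
  I.filter fun i => a i x = b i

open Classical in
/-- The active sets of the points of the polyhedron. -/
noncomputable def activeSets (I : Finset ι) (a : ι → Dual ℝ E) (b : ι → ℝ) : Finset (Finset ι) :=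
  I.powerset.filter fun A => ∃ x ∈ carrier I a b, active I a b x = A

/-- The points of the polyhedron at which all inequalities in `A` are equalities. -/
def face (I : Finset ι) (a : ι → Dual ℝ E) (b : ι → ℝ) (A : Finset ι) : Set E :=
  {x ∈ carrier I a b | A ⊆ active I a b x}

/-- A polyhedron is simple if the functionals active at each of its points are independent. -/
def IsSimple (I : Finset ι) (a : ι → Dual ℝ E) (b : ι → ℝ) : Prop :=
  ∀ A ∈ activeSets I a b, LinearIndepOn ℝ a (A : Set ι)

variable {I : Finset ι} {a : ι → Dual ℝ E} {b : ι → ℝ}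

theorem mem_active {x : E} {i : ι} : i ∈ active I a b x ↔ i ∈ I ∧ a i x = b i := by
  simp [active]

theorem mem_activeSets {A : Finset ι} :
    A ∈ activeSets I a b ↔ ∃ x ∈ carrier I a b, active I a b x = A := by
  simp only [activeSets, Finset.mem_filter, Finset.mem_powerset, and_iff_right_iff_imp]
  rintro ⟨x, -, rfl⟩
  exact Finset.filter_subset _ _

theorem active_mem_activeSets {x : E} (hx : x ∈ carrier I a b) :
    active I a b x ∈ activeSets I a b := mem_activeSets.2 ⟨x, hx, rfl⟩

theorem mem_face {A : Finset ι} {x : E} :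
    x ∈ face I a b A ↔ x ∈ carrier I a b ∧ A ⊆ active I a b x := Iff.rfl

theorem face_empty : face I a b ∅ = carrier I a b := by
  ext
  simp [face]

theorem self_mem_face {x : E} (hx : x ∈ carrier I a b) : x ∈ face I a b (active I a b x) :=
  ⟨hx, subset_rfl⟩

/-- The prescribed values define a functional on the span of the `a i`; its extension to the whole
dual is evaluation at a vector, by reflexivity in finite dimension. -/
theorem exists_forall_apply_eq [FiniteDimensional ℝ E] {A : Set ι} (h : LinearIndepOn ℝ a A)
    (r : ι → ℝ) : ∃ d, ∀ i ∈ A, a i d = r i := by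
  have h' := h.linearIndependent
  obtain ⟨g, hg⟩ := LinearMap.exists_extend
    ((Finsupp.linearCombination ℝ (fun i : A => r i)) ∘ₗ h'.repr)
  refine ⟨(evalEquiv ℝ E).symm g, fun i hi => ?_⟩
  rw [apply_evalEquiv_symm_apply]
  have hs : a i ∈ Submodule.span ℝ (Set.range fun i : A => a i) :=
    Submodule.subset_span ⟨⟨i, hi⟩, rfl⟩
  have := LinearMap.congr_fun hg ⟨a i, hs⟩
  rw [LinearMap.comp_apply, LinearMap.comp_apply, h'.repr_eq_single ⟨i, hi⟩ ⟨a i, hs⟩ rfl] at this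
  simpa using this

/-- Small moves in a direction that is feasible for the active inequalities stay inside. -/
theorem eventually_add_smul_mem {x d : E} (hx : x ∈ carrier I a b)
    (hd : ∀ i ∈ active I a b x, a i d ≤ 0) :
    ∀ᶠ t in 𝓝[>] (0 : ℝ), x + t • d ∈ carrier I a b ∧
      active I a b (x + t • d) = (active I a b x).filter fun i => a i d = 0 := by
  have key : ∀ i ∈ I, ∀ᶠ t in 𝓝[>] (0 : ℝ), a i (x + t • d) ≤ b i ∧
      (a i (x + t • d) = b i ↔ a i x = b i ∧ a i d = 0) := by
    intro i hi
    rcases (hx i hi).eq_or_lt with h | h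
    · filter_upwards [self_mem_nhdsWithin] with t ht
      have ht : 0 < t := ht
      have := hd i (mem_active.2 ⟨hi, h⟩)
      simp only [map_add, map_smul, smul_eq_mul, h, true_and, add_eq_left, mul_eq_zero, ht.ne',
        false_or, iff_self, and_true, add_le_iff_nonpos_right]
      exact mul_nonpos_of_nonneg_of_nonpos ht.le this
    · have hc : ContinuousAt (fun t : ℝ => a i x + t * a i d) 0 := by fun_prop
      have h0 : ∀ᶠ t in 𝓝 (0 : ℝ), a i x + t * a i d < b i :=
        hc.eventually_lt continuousAt_const (by simpa using h)
      filter_upwards [nhdsWithin_le_nhds h0] with t ht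
      simp only [map_add, map_smul, smul_eq_mul]
      exact ⟨ht.le, by simp [ht.ne, h.ne]⟩
  filter_upwards [(Filter.eventually_all_finset I).2 key] with t ht
  refine ⟨fun i hi => (ht i hi).1, ?_⟩
  ext i
  simp only [mem_active, Finset.mem_filter]
  constructor
  · rintro ⟨hi, h⟩
    exact ⟨⟨hi, ((ht i hi).2.1 h).1⟩, ((ht i hi).2.1 h).2⟩
  · rintro ⟨⟨hi, h⟩, h'⟩
    exact ⟨hi, (ht i hi).2.2 ⟨h, h'⟩⟩

theorem exists_add_smul_mem {x d : E} (hx : x ∈ carrier I a b)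
    (hd : ∀ i ∈ active I a b x, a i d ≤ 0) :
    ∃ t : ℝ, 0 < t ∧ x + t • d ∈ carrier I a b ∧
      active I a b (x + t • d) = (active I a b x).filter fun i => a i d = 0 :=
  ((eventually_mem_nhdsWithin (a := (0 : ℝ)) (s := Set.Ioi 0)).and
    (eventually_add_smul_mem hx hd)).exists

theorem exists_add_smul_mem_face {x d : E} {A : Finset ι} (hx : x ∈ face I a b A)
    (hd : ∀ i ∈ active I a b x, a i d ≤ 0) (hA : ∀ i ∈ A, a i d = 0) :
    ∃ t : ℝ, 0 < t ∧ x + t • d ∈ face I a b A := by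
  obtain ⟨t, ht, h1, h2⟩ := exists_add_smul_mem hx.1 hd
  refine ⟨t, ht, h1, fun i hi => ?_⟩
  rw [h2]
  exact Finset.mem_filter.2 ⟨hx.2 hi, hA i hi⟩

/-- Independence supplies a direction that keeps the equalities in `A` and relaxes those in `B \ A`.
Thus the active sets of a simple polyhedron form a simplicial complex. -/
theorem mem_activeSets_of_subset [FiniteDimensional ℝ E] (hs : IsSimple I a b) {A B : Finset ι}
    (hB : B ∈ activeSets I a b) (hAB : A ⊆ B) : A ∈ activeSets I a b := by
  classical
  obtain ⟨d, hd⟩ := exists_forall_apply_eq (hs B hB) fun i => if i ∈ A then 0 else -1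
  obtain ⟨x, hx, rfl⟩ := mem_activeSets.1 hB
  obtain ⟨t, -, h1, h2⟩ := exists_add_smul_mem (d := d) hx fun i hi => by
    rw [hd i hi]; split_ifs <;> norm_num
  refine mem_activeSets.2 ⟨_, h1, ?_⟩
  rw [h2]
  ext i
  simp only [Finset.mem_filter]
  constructor
  · rintro ⟨hi, h⟩
    rw [hd i hi] at h
    by_contra hiA
    simp [hiA] at h
  · intro hi
    exact ⟨hAB hi, by rw [hd i (hAB hi), if_pos hi]⟩

theorem convex_carrier : Convex ℝ (carrier I a b) := by
  have : carrier I a b = ⋂ i ∈ I, {x | a i x ≤ b i} := by ext; simp [carrier]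
  rw [this]
  exact convex_iInter₂ fun i _ => convex_halfSpace_le (a i).isLinear _

theorem isClosed_carrier [FiniteDimensional ℝ E] : IsClosed (carrier I a b) := by
  have : carrier I a b = ⋂ i ∈ I, {x | a i x ≤ b i} := by ext; simp [carrier]
  rw [this]
  exact isClosed_biInter fun i _ =>
    isClosed_le (a i).continuous_of_finiteDimensional continuous_const

theorem isClosed_face [FiniteDimensional ℝ E] (A : Finset ι) : IsClosed (face I a b A) := by
  have : face I a b A = carrier I a b ∩ ⋂ i ∈ A, {x | i ∈ I ∧ a i x = b i} := by
    ext; simp [face, Finset.subset_iff, mem_active]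
  rw [this]
  refine isClosed_carrier.inter (isClosed_biInter fun i _ => ?_)
  by_cases hi : i ∈ I
  · simp only [hi, true_and]
    exact isClosed_eq (a i).continuous_of_finiteDimensional continuous_const
  · simp [hi]

theorem active_midpoint {x y : E} (hx : x ∈ carrier I a b) (hy : y ∈ carrier I a b) [DecidableEq ι] :
    active I a b (midpoint ℝ x y) = active I a b x ∩ active I a b y := by
  ext i
  simp only [mem_active, Finset.mem_inter, midpoint_eq_smul_add, map_smul, map_add, smul_eq_mul]
  constructor
  · rintro ⟨hi, h⟩
    have h1 := hx i hi
    have h2 := hy i hi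
    rw [invOf_eq_inv] at h
    exact ⟨⟨hi, by linarith⟩, hi, by linarith⟩
  · rintro ⟨⟨hi, h⟩, -, h'⟩
    refine ⟨hi, ?_⟩
    rw [invOf_eq_inv]
    linarith

/-! ### Faces -/

/-- The sum of the active functionals is maximal exactly where each of them attains its bound. -/
theorem isExposed_face [FiniteDimensional ℝ E] {A : Finset ι} (hA : A ∈ activeSets I a b) :
    IsExposed ℝ (carrier I a b) (face I a b A) := by
  intro _
  obtain ⟨y, hy, rfl⟩ := mem_activeSets.1 hA
  refine ⟨LinearMap.toContinuousLinearMap (∑ i ∈ active I a b y, a i), ?_⟩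
  have hval : ∀ x, LinearMap.toContinuousLinearMap (∑ i ∈ active I a b y, a i) x =
      ∑ i ∈ active I a b y, a i x := fun x => by simp
  have hle : ∀ x ∈ carrier I a b, ∀ i ∈ active I a b y, a i x ≤ b i :=
    fun x hx i hi => hx i (mem_active.1 hi).1
  have hyv : ∑ i ∈ active I a b y, a i y = ∑ i ∈ active I a b y, b i :=
    Finset.sum_congr rfl fun i hi => (mem_active.1 hi).2
  ext x
  simp only [hval, mem_face, Set.mem_ofPred_eq]
  refine and_congr_right fun hx => ⟨fun h z hz => ?_, fun h i hi => ?_⟩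
  · refine (Finset.sum_le_sum (hle z hz)).trans (Finset.sum_le_sum fun i hi => ?_)
    exact (mem_active.1 (h hi)).2.ge
  · have h1 := h y hy
    rw [hyv] at h1
    have h2 := (Finset.sum_eq_sum_iff_of_le (hle x hx)).1
      (le_antisymm (Finset.sum_le_sum (hle x hx)) h1)
    exact mem_active.2 ⟨(mem_active.1 hi).1, h2 i hi⟩

/-- A point of `F` with minimal active set plays the role of a relative interior point: passing to
midpoints intersects active sets, so its active set lies in that of every other point of `F`. -/
theorem exists_eq_face_of_isExposed {F : Set E} (hne : F.Nonempty)
    (hF : IsExposed ℝ (carrier I a b) F) : ∃ A ∈ activeSets I a b, F = face I a b A := by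
  classical
  obtain ⟨l, rfl⟩ := hF hne
  set F := {x ∈ carrier I a b | ∀ y ∈ carrier I a b, l y ≤ l x}
  obtain ⟨_, ⟨x, hxF, rfl⟩, hm⟩ := exists_minimal_of_wellFoundedLT
    (fun A => ∃ x ∈ F, active I a b x = A) (hne.elim fun x hx => ⟨_, x, hx, rfl⟩)
  have hmin : ∀ y ∈ F, active I a b y ⊆ active I a b x → active I a b x ⊆ active I a b y :=
    fun y hy h => hm ⟨y, hy, rfl⟩ h
  refine ⟨_, active_mem_activeSets hxF.1, Set.Subset.antisymm (fun y hy => ⟨hy.1, ?_⟩) ?_⟩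
  · have hm : midpoint ℝ x y ∈ F := by
      refine ⟨convex_carrier.midpoint_mem hxF.1 hy.1, fun z hz => ?_⟩
      have h1 := hxF.2 z hz
      have h2 := hy.2 z hz
      rw [midpoint_eq_smul_add, map_smul, map_add, smul_eq_mul, invOf_eq_inv]
      linarith
    have := hmin _ hm
    rw [active_midpoint hxF.1 hy.1] at this
    exact (this Finset.inter_subset_left).trans Finset.inter_subset_right
  · rintro y ⟨hy, hxy⟩
    -- The segment from `y` to `x` can be prolonged beyond `x`, so `l y < l x` would contradict
    -- maximality at `x`.
    obtain ⟨t, ht, h, -⟩ := exists_add_smul_mem (d := x - y) hxF.1 fun i hi => by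
      rw [map_sub, (mem_active.1 hi).2, (mem_active.1 (hxy hi)).2, sub_self]
    have h1 := hxF.2 _ h
    rw [map_add, map_smul, map_sub, smul_eq_mul] at h1
    have h2 : l x ≤ l y := by
      by_contra! h3
      nlinarith
    exact ⟨hy, fun z hz => (hxF.2 z hz).trans h2⟩

theorem face_injOn : Set.InjOn (face I a b) (activeSets I a b) := by
  intro A hA B hB h
  obtain ⟨x, hx, rfl⟩ := mem_activeSets.1 hA
  obtain ⟨y, hy, rfl⟩ := mem_activeSets.1 hB
  have h1 := self_mem_face hx
  have h2 := self_mem_face hy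
  rw [h] at h1
  rw [← h] at h2
  exact Finset.Subset.antisymm h2.2 h1.2

/-- From a point whose active set is exactly `A`, every direction in the common kernel stays in the
face for a short while. -/
theorem vectorSpan_face {A : Finset ι} (hA : A ∈ activeSets I a b) :
    vectorSpan ℝ (face I a b A) = ⨅ i : A, LinearMap.ker (a i) := by
  obtain ⟨x, hx, rfl⟩ := mem_activeSets.1 hA
  apply le_antisymm
  · rw [vectorSpan_def, Submodule.span_le]
    rintro _ ⟨y, hy, z, hz, rfl⟩
    simp only [SetLike.mem_coe, Submodule.mem_iInf, LinearMap.mem_ker, vsub_eq_sub, map_sub]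
    rintro ⟨i, hi⟩
    simp only
    rw [(mem_active.1 (hy.2 hi)).2, (mem_active.1 (hz.2 hi)).2, sub_self]
  · intro d hd
    simp only [Submodule.mem_iInf, LinearMap.mem_ker, Subtype.forall] at hd
    obtain ⟨t, ht, h⟩ := exists_add_smul_mem_face (d := d) (self_mem_face hx)
      (fun i hi => (hd i hi).le) hd
    have h3 := vsub_mem_vectorSpan ℝ h (self_mem_face hx)
    rw [vsub_eq_sub, add_sub_cancel_left] at h3
    exact (Submodule.smul_mem_iff _ ht.ne').1 h3

theorem finrank_iInf_ker_add_card [FiniteDimensional ℝ E] {A : Finset ι}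
    (hA : LinearIndepOn ℝ a (A : Set ι)) :
    finrank ℝ (⨅ i : A, LinearMap.ker (a i) : Submodule ℝ E) + A.card = finrank ℝ E := by
  have hsurj : Function.Surjective (LinearMap.pi fun i : A => a i) := by
    classical
    intro r
    obtain ⟨d, hd⟩ := exists_forall_apply_eq hA fun i => if h : i ∈ A then r ⟨i, h⟩ else 0
    refine ⟨d, funext fun i => ?_⟩
    have := hd i i.2
    simpa using this
  have h := LinearMap.finrank_range_add_finrank_ker (LinearMap.pi fun i : A => a i)
  rw [LinearMap.range_eq_top.2 hsurj, finrank_top, LinearMap.ker_pi, finrank_fintype_fun_eq_card,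
    Fintype.card_coe] at h
  omega

theorem finrank_vectorSpan_face_add_card [FiniteDimensional ℝ E] (hs : IsSimple I a b)
    {A : Finset ι} (hA : A ∈ activeSets I a b) :
    finrank ℝ (vectorSpan ℝ (face I a b A)) + A.card = finrank ℝ E := by
  rw [vectorSpan_face hA, finrank_iInf_ker_add_card (hs A hA)]

theorem setOf_isExposed_eq_image [FiniteDimensional ℝ E] (hs : IsSimple I a b) (k : ℕ) :
    {F | F.Nonempty ∧ IsExposed ℝ (carrier I a b) F ∧ finrank ℝ (vectorSpan ℝ F) = k} =
      face I a b '' ((activeSets I a b).filter fun A => A.card + k = finrank ℝ E) := by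
  ext F
  simp only [Set.mem_ofPred_eq, Finset.coe_filter, Set.mem_image]
  constructor
  · rintro ⟨hne, hF, hk⟩
    obtain ⟨A, hA, rfl⟩ := exists_eq_face_of_isExposed hne hF
    exact ⟨A, ⟨hA, by rw [← finrank_vectorSpan_face_add_card hs hA, hk, add_comm]⟩, rfl⟩
  · rintro ⟨A, ⟨hA, hk⟩, rfl⟩
    refine ⟨?_, isExposed_face hA, ?_⟩
    · obtain ⟨x, hx, rfl⟩ := mem_activeSets.1 hA
      exact ⟨x, self_mem_face hx⟩
    · have := finrank_vectorSpan_face_add_card hs hA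
      omega

theorem ncard_setOf_isExposed [FiniteDimensional ℝ E] (hs : IsSimple I a b) (k : ℕ) :
    {F | F.Nonempty ∧ IsExposed ℝ (carrier I a b) F ∧ finrank ℝ (vectorSpan ℝ F) = k}.ncard =
      ((activeSets I a b).filter fun A => A.card + k = finrank ℝ E).card := by
  rw [setOf_isExposed_eq_image hs, Set.InjOn.ncard_image, Set.ncard_coe_finset]
  exact face_injOn.mono (Finset.coe_subset.2 (Finset.filter_subset _ _))

/-! ### Vertices, and bounded simple polyhedra as convex hulls -/

theorem card_le_finrank [FiniteDimensional ℝ E] (hs : IsSimple I a b) {A : Finset ι}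
    (hA : A ∈ activeSets I a b) : A.card ≤ finrank ℝ E := by
  have := finrank_iInf_ker_add_card (hs A hA)
  omega

/-- A point at which a full set of independent inequalities is active is determined by it. -/
theorem eq_of_card_active_eq [FiniteDimensional ℝ E] (hs : IsSimple I a b) {x y : E}
    (hx : x ∈ carrier I a b) (hcard : (active I a b x).card = finrank ℝ E)
    (hxy : active I a b x ⊆ active I a b y) : y = x := by
  have h := finrank_iInf_ker_add_card (hs _ (active_mem_activeSets hx))
  have h0 : (⨅ i : active I a b x, LinearMap.ker (a i) : Submodule ℝ E) = ⊥ :=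
    Submodule.finrank_eq_zero.1 (by omega)
  rw [← sub_eq_zero, ← Submodule.mem_bot ℝ, ← h0]
  simp only [Submodule.mem_iInf, LinearMap.mem_ker, map_sub, Subtype.forall]
  intro i hi
  rw [(mem_active.1 (hxy hi)).2, (mem_active.1 hi).2, sub_self]

/-- By Krein–Milman it suffices that there are finitely many extreme points. Each has a full active
set, which determines it. -/
theorem exists_finset_eq_convexHull [FiniteDimensional ℝ E] (hs : IsSimple I a b)
    (hb : Bornology.IsBounded (carrier I a b)) :
    ∃ S : Finset E, carrier I a b = convexHull ℝ (S : Set E) := by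
  have hK : IsCompact (carrier I a b) := Metric.isCompact_of_isClosed_isBounded isClosed_carrier hb
  have hext : ∀ x ∈ Set.extremePoints ℝ (carrier I a b),
      (active I a b x).card = finrank ℝ E := by
    intro x hx
    have h := finrank_iInf_ker_add_card (hs _ (active_mem_activeSets hx.1))
    by_contra hne
    obtain ⟨d, hd, hd0⟩ := (Submodule.ne_bot_iff _).1
      (show (⨅ i : active I a b x, LinearMap.ker (a i) : Submodule ℝ E) ≠ ⊥ by
        intro h0
        rw [h0, finrank_bot] at h
        omega)
    simp only [Submodule.mem_iInf, LinearMap.mem_ker, Subtype.forall] at hd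
    -- Moving along both `d` and `-d` places `x` in the middle of a segment, against extremality.
    have h1 := eventually_add_smul_mem hx.1 fun i hi => (hd i hi).le
    have h2 := eventually_add_smul_mem (d := -d) hx.1 fun i hi => by simp [hd i hi]
    obtain ⟨t, ht, ⟨h1, -⟩, h2, -⟩ :=
      ((eventually_mem_nhdsWithin (a := (0 : ℝ)) (s := Set.Ioi 0)).and (h1.and h2)).exists
    have ht : 0 < t := ht
    have h3 := hx.2 h1 h2 ⟨1 / 2, 1 / 2, by norm_num, by norm_num, by norm_num, by
      module⟩
    rw [add_eq_left, smul_eq_zero] at h3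
    exact h3.elim ht.ne' hd0
  have hfin : (Set.extremePoints ℝ (carrier I a b)).Finite := by
    refine Set.Finite.of_finite_image (f := active I a b) ?_ ?_
    · refine (activeSets I a b).finite_toSet.subset ?_
      rintro _ ⟨x, hx, rfl⟩
      exact active_mem_activeSets hx.1
    · intro x hx y hy hxy
      exact (eq_of_card_active_eq hs hx.1 (hext x hx) hxy.le).symm
  refine ⟨hfin.toFinset, ?_⟩
  rw [hfin.coe_toFinset, ← (hfin.isCompact_convexHull ℝ).isClosed.closure_eq,
    closure_convexHull_extremePoints hK convex_carrier]

end Polyhedron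

/-! ### Counting faces of bounded simple polyhedra -/

namespace Polyhedron

open Module Filter Topology

variable {ι E : Type*} [NormedAddCommGroup E] [NormedSpace ℝ E] {I : Finset ι}
  {a : ι → Dual ℝ E} {b : ι → ℝ}

/-- The active sets of the vertices. -/
noncomputable def vertexSets (I : Finset ι) (a : ι → Dual ℝ E) (b : ι → ℝ) : Finset (Finset ι) :=
  (activeSets I a b).filter fun B => B.card = finrank ℝ E

/-- `l` lies in no span of fewer than `dim E` functionals that are active at some point. -/
def IsGeneric (I : Finset ι) (a : ι → Dual ℝ E) (b : ι → ℝ) (l : Dual ℝ E) : Prop :=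
  ∀ A ∈ activeSets I a b, A.card < finrank ℝ E → l ∉ Submodule.span ℝ (a '' (A : Set ι))

theorem IsGeneric.neg {l : Dual ℝ E} (h : IsGeneric I a b l) : IsGeneric I a b (-l) :=
  fun A hA hc hm => h A hA hc (by simpa using hm)

/-- Uniqueness of the top vertex of a face: positive coefficients outside `A` make `l` maximal on
the face of `A` at the vertex, and equality there forces every inequality of `B` to be active. -/
theorem eq_of_forall_pos {l : Dual ℝ E} {c : Finset ι → ι → ℝ}
    (hc : ∀ B ∈ vertexSets I a b, l = ∑ i ∈ B, c B i • a i) {A B B' : Finset ι}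
    (hB : B ∈ vertexSets I a b) (hB' : B' ∈ vertexSets I a b) (hAB : A ⊆ B) (hAB' : A ⊆ B')
    (h : ∀ i ∈ B, i ∉ A → 0 < c B i) (h' : ∀ i ∈ B', i ∉ A → 0 < c B' i) : B = B' := by
  have key : ∀ {B : Finset ι} {y z : E}, B ∈ vertexSets I a b → (∀ i ∈ B, i ∉ A → 0 < c B i) →
      active I a b y = B → z ∈ carrier I a b → A ⊆ active I a b z →
      l z ≤ l y ∧ (l z = l y → B ⊆ active I a b z) := by
    rintro B y z hB h rfl hz hAz
    have hval : ∀ w, l w = ∑ i ∈ active I a b y, c (active I a b y) i * a i w := by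
      intro w
      conv_lhs => rw [hc _ hB]
      simp
    have hle : ∀ i ∈ active I a b y,
        c (active I a b y) i * a i z ≤ c (active I a b y) i * a i y := by
      intro i hi
      by_cases hiA : i ∈ A
      · rw [(mem_active.1 (hAz hiA)).2, (mem_active.1 hi).2]
      · rw [(mem_active.1 hi).2]
        exact mul_le_mul_of_nonneg_left (hz i (mem_active.1 hi).1) (h i hi hiA).le
    rw [hval, hval]
    refine ⟨Finset.sum_le_sum hle, fun heq i hi => ?_⟩
    have h2 := (Finset.sum_eq_sum_iff_of_le hle).1 heq i hi
    by_cases hiA : i ∈ A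
    · exact hAz hiA
    · refine mem_active.2 ⟨(mem_active.1 hi).1, ?_⟩
      rw [← (mem_active.1 hi).2]
      exact mul_left_cancel₀ (h i hi hiA).ne' h2
  obtain ⟨y, hy, hyB⟩ := mem_activeSets.1 (Finset.mem_filter.1 hB).1
  obtain ⟨y', hy', hyB'⟩ := mem_activeSets.1 (Finset.mem_filter.1 hB').1
  have h1 := key hB h hyB hy' (hyB' ▸ hAB')
  have h2 := key hB' h' hyB' hy (hyB ▸ hAB)
  have h3 := h1.2 (le_antisymm h1.1 h2.1)
  rw [hyB'] at h3
  exact Finset.eq_of_subset_of_card_le h3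
    ((Finset.mem_filter.1 hB').2.trans (Finset.mem_filter.1 hB).2.symm).le

/-- A real vector space is not a finite union of proper subspaces. -/
theorem exists_isGeneric : ∃ l : Dual ℝ E, IsGeneric I a b l := by
  classical
  set s : Finset (Submodule ℝ (Dual ℝ E)) :=
    ((activeSets I a b).filter fun A : Finset ι => A.card < finrank ℝ E).image
      fun A : Finset ι => Submodule.span ℝ (a '' (A : Set ι))
  have hs : (⊤ : Submodule ℝ (Dual ℝ E)) ∉ s := by
    intro h
    obtain ⟨A, hA, htop⟩ := Finset.mem_image.1 h
    have h1 := finrank_span_finset_le_card (R := ℝ) (A.image a)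
    rw [Set.finrank, Finset.coe_image, htop, finrank_top, Subspace.dual_finrank_eq] at h1
    have h2 := (Finset.mem_filter.1 hA).2
    have h3 := Finset.card_image_le (s := A) (f := a)
    omega
  obtain ⟨l, hl⟩ := (Set.ne_univ_iff_exists_notMem _).1 (Subspace.biUnion_ne_univ_of_top_notMem hs)
  refine ⟨l, fun A hA hc hmem => hl ?_⟩
  exact Set.mem_biUnion (Finset.mem_image.2 ⟨A, Finset.mem_filter.2 ⟨hA, hc⟩, rfl⟩) hmem

theorem mem_span_image_of_forall {A : Finset ι} {l : Dual ℝ E}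
    (h : ∀ d, (∀ i ∈ A, a i d = 0) → l d = 0) : l ∈ Submodule.span ℝ (a '' (A : Set ι)) := by
  have := mem_span_of_iInf_ker_le_ker (L := fun i : A => a i) (K := l) fun d hd => by
    simp only [Submodule.mem_iInf, LinearMap.mem_ker, Subtype.forall] at hd ⊢
    exact h d hd
  rwa [Set.image_eq_range]

variable [FiniteDimensional ℝ E]

/-- A functional is a combination of the functionals active at a vertex. -/
theorem exists_eq_sum (hs : IsSimple I a b) (l : Dual ℝ E) {B : Finset ι}
    (hB : B ∈ vertexSets I a b) : ∃ c : ι → ℝ, l = ∑ i ∈ B, c i • a i := by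
  obtain ⟨hB, hc⟩ := Finset.mem_filter.1 hB
  have hl : l ∈ Submodule.span ℝ (a '' (B : Set ι)) := by
    refine mem_span_image_of_forall fun d hd => ?_
    have h := finrank_iInf_ker_add_card (hs B hB)
    have h0 : (⨅ i : B, LinearMap.ker (a i) : Submodule ℝ E) = ⊥ :=
      Submodule.finrank_eq_zero.1 (by omega)
    have : d ∈ (⨅ i : B, LinearMap.ker (a i) : Submodule ℝ E) := by
      simpa [Submodule.mem_iInf] using hd
    rw [h0, Submodule.mem_bot] at this
    rw [this, map_zero]
  classical
  obtain ⟨c, hc⟩ := (Submodule.mem_span_image_finset_iff_exists_fun ℝ).1 hl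
  refine ⟨fun i => if h : i ∈ B then c ⟨i, h⟩ else 0, ?_⟩
  rw [← hc, ← Finset.sum_coe_sort B]
  exact Finset.sum_congr rfl fun i _ => by simp

theorem coeff_ne_zero (hs : IsSimple I a b) {l : Dual ℝ E} (hl : IsGeneric I a b l) {B : Finset ι}
    (hB : B ∈ vertexSets I a b) {c : ι → ℝ} (hc : l = ∑ i ∈ B, c i • a i) {i : ι} (hi : i ∈ B) :
    c i ≠ 0 := by
  classical
  intro h0
  obtain ⟨hB, hcard⟩ := Finset.mem_filter.1 hB
  refine hl (B.erase i) (mem_activeSets_of_subset hs hB (Finset.erase_subset _ _)) ?_ ?_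
  · rw [← hcard]
    exact Finset.card_erase_lt_of_mem hi
  · rw [hc, ← Finset.add_sum_erase _ _ hi, h0, zero_smul, zero_add]
    exact Submodule.sum_mem _ fun j hj => Submodule.smul_mem _ _
      (Submodule.subset_span ⟨j, hj, rfl⟩)

/-- Every face has a vertex at which a generic functional is maximal on the face. -/
theorem exists_forall_pos (hs : IsSimple I a b) (hb : Bornology.IsBounded (carrier I a b))
    {l : Dual ℝ E} (hl : IsGeneric I a b l) {c : Finset ι → ι → ℝ}
    (hc : ∀ B ∈ vertexSets I a b, l = ∑ i ∈ B, c B i • a i) {A : Finset ι}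
    (hA : A ∈ activeSets I a b) :
    ∃ B ∈ vertexSets I a b, A ⊆ B ∧ ∀ i ∈ B, i ∉ A → 0 < c B i := by
  classical
  obtain ⟨x, hx, hxA⟩ := mem_activeSets.1 hA
  have hK : IsCompact (face I a b A) :=
    Metric.isCompact_of_isClosed_isBounded (isClosed_face A) (hb.subset fun _ h => h.1)
  obtain ⟨y, hy, hmax⟩ := hK.exists_isMaxOn ⟨x, hx, hxA.ge⟩
    l.continuous_of_finiteDimensional.continuousOn
  -- First-order optimality of the maximizer `y` on the face.
  have hopt : ∀ d, (∀ i ∈ active I a b y, a i d ≤ 0) → (∀ i ∈ A, a i d = 0) → l d ≤ 0 := by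
    intro d h1 h2
    obtain ⟨t, ht, h⟩ := exists_add_smul_mem_face hy h1 h2
    have h3 : l (y + t • d) ≤ l y := hmax h
    rw [map_add, map_smul, smul_eq_mul, add_le_iff_nonpos_right] at h3
    by_contra! h4
    exact absurd h3 (mul_pos ht h4).not_ge
  have hyS := active_mem_activeSets hy.1
  have hyV : active I a b y ∈ vertexSets I a b := by
    refine Finset.mem_filter.2 ⟨hyS, (card_le_finrank hs hyS).antisymm ?_⟩
    by_contra! hlt
    -- If `y` were not a vertex, optimality along `d` and `-d` would make `l` vanish on the common
    -- kernel of the active functionals, hence lie in their span.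
    refine hl _ hyS hlt (mem_span_image_of_forall fun d hd => ?_)
    have h1 := hopt d (fun i hi => (hd i hi).le) fun i hi => hd i (hy.2 hi)
    have h2 := hopt (-d) (fun i hi => by simp [hd i hi]) fun i hi => by simp [hd i (hy.2 hi)]
    rw [map_neg] at h2
    linarith
  refine ⟨_, hyV, hy.2, fun i hi hiA => (coeff_ne_zero hs hl hyV (hc _ hyV) hi).lt_of_le' ?_⟩
  -- The direction `d` leaves `y` along the edge that drops the inequality `i`; there `l d = -c i`.
  obtain ⟨d, hd⟩ := exists_forall_apply_eq (hs _ hyS) fun j => if j = i then -1 else 0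
  have h1 := hopt d (fun j hj => by rw [hd j hj]; split_ifs <;> norm_num) fun j hj => by
    rw [hd j (hy.2 hj), if_neg]
    rintro rfl
    exact hiA hj
  rw [hc _ hyV, LinearMap.sum_apply, Finset.sum_eq_single_of_mem i hi] at h1
  · simpa [hd i hi] using h1
  · intro j hj hji
    simp [hd j hj, hji]

/-- The number of `k`-dimensional faces, counted through their top vertices. -/
theorem card_filter_activeSets (hs : IsSimple I a b) (hb : Bornology.IsBounded (carrier I a b))
    {l : Dual ℝ E} (hl : IsGeneric I a b l) {c : Finset ι → ι → ℝ}
    (hc : ∀ B ∈ vertexSets I a b, l = ∑ i ∈ B, c B i • a i) (k : ℕ) :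
    ((activeSets I a b).filter fun A => A.card + k = finrank ℝ E).card =
      ∑ B ∈ vertexSets I a b, (B.filter fun i => 0 < c B i).card.choose k := by
  classical
  choose! top htop using fun A hA => exists_forall_pos hs hb hl hc (A := A) hA
  rw [Finset.card_eq_sum_card_fiberwise (f := top) (t := vertexSets I a b)
    fun A hA => (htop A (Finset.mem_filter.1 hA).1).1]
  refine Finset.sum_congr rfl fun B hB => ?_
  obtain ⟨hBS, hBc⟩ := Finset.mem_filter.1 hB
  rw [← Finset.card_powersetCard]
  -- A face with top vertex `B` corresponds to the set of inequalities of `B` that it drops, all of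
  -- positive coefficient; uniqueness of the top vertex shows that every such set occurs.
  refine Finset.card_nbij' (fun A => B \ A) (fun C => B \ C) ?_ ?_ ?_ ?_
  · intro A hA
    simp only [Finset.coe_filter, Finset.mem_filter, Set.mem_ofPred_eq] at hA
    obtain ⟨⟨hA, hk⟩, rfl⟩ := hA
    obtain ⟨h1, h2, h3⟩ := htop A hA
    simp only [Finset.mem_coe, Finset.mem_powersetCard]
    refine ⟨fun i hi => ?_, ?_⟩
    · rw [Finset.mem_sdiff] at hi
      exact Finset.mem_filter.2 ⟨hi.1, h3 i hi.1 hi.2⟩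
    · rw [Finset.card_sdiff_of_subset h2]
      omega
  · intro C hC
    simp only [Finset.mem_coe, Finset.mem_powersetCard] at hC
    have hCB : C ⊆ B := hC.1.trans (Finset.filter_subset _ _)
    have hS := mem_activeSets_of_subset hs hBS (Finset.sdiff_subset (s := B) (t := C))
    simp only [Finset.coe_filter, Finset.mem_filter, Set.mem_ofPred_eq]
    refine ⟨⟨hS, ?_⟩, ?_⟩
    · rw [Finset.card_sdiff_of_subset hCB]
      have := Finset.card_le_card hCB
      omega
    · obtain ⟨h1, h2, h3⟩ := htop _ hS
      refine eq_of_forall_pos hc h1 hB h2 Finset.sdiff_subset h3 fun i hi hiC => ?_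
      have : i ∈ C := by simpa [hi] using hiC
      exact (Finset.mem_filter.1 (hC.1 this)).2
  · intro A hA
    simp only [Finset.coe_filter, Finset.mem_filter, Set.mem_ofPred_eq] at hA
    obtain ⟨⟨hA, hk⟩, rfl⟩ := hA
    exact Finset.sdiff_sdiff_eq_self (htop A hA).2.1
  · intro C hC
    simp only [Finset.mem_coe, Finset.mem_powersetCard] at hC
    exact Finset.sdiff_sdiff_eq_self (hC.1.trans (Finset.filter_subset _ _))

/-- The face numbers of a bounded simple polyhedron of dimension three. -/
theorem card_activeSets_of_finrank_eq_three (hs : IsSimple I a b)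
    (hb : Bornology.IsBounded (carrier I a b)) (hne : (carrier I a b).Nonempty)
    (h3 : finrank ℝ E = 3) {n : ℕ → ℕ}
    (hn : ∀ k, n k = ((activeSets I a b).filter fun A => A.card + k = 3).card) :
    2 * n 1 = 3 * n 0 ∧ 2 * n 2 = n 0 + 4 := by
  obtain ⟨l, hl⟩ := exists_isGeneric (I := I) (a := a) (b := b)
  choose! c hc using fun B hB => exists_eq_sum hs l (B := B) hB
  have hc' : ∀ B ∈ vertexSets I a b, -l = ∑ i ∈ B, (-c B) i • a i := by
    intro B hB
    conv_lhs => rw [hc B hB]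
    ext x
    simp [Finset.sum_neg_distrib]
  set p : Finset ι → ℕ := fun B => (B.filter fun i => 0 < c B i).card
  have hp : ∀ k, n k = ∑ B ∈ vertexSets I a b, (p B).choose k := fun k => by
    rw [hn, ← h3, card_filter_activeSets hs hb hl hc]
  have hq : ∀ k, n k = ∑ B ∈ vertexSets I a b, (3 - p B).choose k := fun k => by
    rw [hn, ← h3, card_filter_activeSets hs hb hl.neg hc']
    refine Finset.sum_congr rfl fun B hB => congrArg (fun m : ℕ => m.choose k) ?_
    rw [← (Finset.mem_filter.1 hB).2, ← Finset.card_filter_add_card_filter_not (s := B)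
      (fun i => 0 < c B i), Nat.add_sub_cancel_left]
    refine congrArg _ (Finset.filter_congr fun i hi => ?_)
    have := coeff_ne_zero hs hl hB (hc B hB) hi
    simp only [Pi.neg_apply, Left.neg_pos_iff, not_lt]
    exact ⟨le_of_lt, this.lt_of_le⟩
  have hle : ∀ B ∈ vertexSets I a b, p B ≤ 3 := fun B hB => by
    rw [← h3, ← (Finset.mem_filter.1 hB).2]
    exact Finset.card_filter_le _ _
  -- The only three-dimensional face is the polyhedron itself, with empty active set.
  have hone : n 3 = 1 := by
    obtain ⟨x, hx⟩ := hne
    rw [hn, Finset.card_eq_one]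
    refine ⟨∅, Finset.ext fun A => ?_⟩
    simp only [Finset.mem_filter, Nat.add_eq_right, Finset.card_eq_zero, Finset.mem_singleton,
      and_iff_right_iff_imp]
    rintro rfl
    exact mem_activeSets_of_subset hs (active_mem_activeSets hx) (Finset.empty_subset _)
  have e1 : ∑ B ∈ vertexSets I a b, (p B).choose 1 + ∑ B ∈ vertexSets I a b, (3 - p B).choose 1 =
      3 * ∑ B ∈ vertexSets I a b, (p B).choose 0 := by
    rw [← Finset.sum_add_distrib, Finset.mul_sum]
    refine Finset.sum_congr rfl fun B hB => ?_
    have := hle B hB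
    simp only [Nat.choose_one_right, Nat.choose_zero_right]
    omega
  -- Pointwise this is `∑ (-1)^k (p B).choose k = (3 - p B).choose 3`, both sides being `1` if `p B
  -- = 0` and `0` otherwise. Summed, it is Euler's relation.
  have e2 : ∑ B ∈ vertexSets I a b, (p B).choose 0 + ∑ B ∈ vertexSets I a b, (p B).choose 2 =
      ∑ B ∈ vertexSets I a b, (p B).choose 1 + ∑ B ∈ vertexSets I a b, (p B).choose 3 +
        ∑ B ∈ vertexSets I a b, (3 - p B).choose 3 := by
    rw [← Finset.sum_add_distrib, ← Finset.sum_add_distrib, ← Finset.sum_add_distrib]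
    refine Finset.sum_congr rfl fun B hB => ?_
    have := hle B hB
    interval_cases p B <;> decide
  rw [← hp, ← hp, ← hq] at e1
  rw [← hp, ← hp, ← hp, ← hp, ← hq] at e2
  omega

end Polyhedron

/-! ### Regions of tropical surfaces and cells of regular subdivisions -/

namespace K3

theorem connectedComponentIn_eq_of_disjoint_cover {X : Type*} [TopologicalSpace X] {S U V : Set X} {x : X}
    (hU : IsOpen U) (hV : IsOpen V) (hS : S = U ∪ V) (hUV : Disjoint U V) (hx : x ∈ U)
    (hc : IsPreconnected U) : connectedComponentIn S x = U := by
  apply Set.Subset.antisymm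
  · refine isPreconnected_connectedComponentIn.subset_left_of_subset_union hU hV hUV
      ((connectedComponentIn_subset _ _).trans hS.le)
      ⟨x, mem_connectedComponentIn (hS ▸ Or.inl hx), hx⟩
  · exact hc.subset_connectedComponentIn hx (hS ▸ Set.subset_union_left)

namespace TropPoly

open Module Polyhedron Filter Topology

noncomputable section

variable (f : TropPoly)

/-- The real value of the coefficient at an exponent in the support. -/
def coeff (v : Fin 3 → ℤ) : ℝ := (f.c v).untopD 0

/-- The real value of the monomial at an exponent in the support. -/
def monomial (v : Fin 3 → ℤ) (x : Fin 3 → ℝ) : ℝ := f.coeff v + toReal v ⬝ᵥ x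

/-- The points at which the monomial `v` is the only minimal one. -/
def openRegion (v : Fin 3 → ℤ) : Set (Fin 3 → ℝ) :=
  {x | ∀ u ∈ f.support, u ≠ v → f.monomial v x < f.monomial u x}

/-- The functional `x ↦ (v - u) · x`. -/
def normal (v u : Fin 3 → ℤ) : Dual ℝ (Fin 3 → ℝ) :=
  dotProductEquiv ℝ (Fin 3) (toReal v - toReal u)

/-- The points at which the monomial `v` is minimal. -/
def closedRegion (v : Fin 3 → ℤ) : Set (Fin 3 → ℝ) :=
  carrier (f.support.erase v) (normal v) fun u => f.coeff u - f.coeff v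

variable {f} {u v w : Fin 3 → ℤ} {x y : Fin 3 → ℝ}

theorem normal_apply : normal v u x = toReal v ⬝ᵥ x - toReal u ⬝ᵥ x := by
  rw [normal, dotProductEquiv_apply_apply, sub_dotProduct]

theorem c_eq_top_iff : f.c v = ⊤ ↔ v ∉ f.support := by
  rw [Finsupp.notMem_support_iff, c, ← Tropical.untrop_zero, Tropical.untrop_inj_iff]

theorem c_eq_coeff (hv : v ∈ f.support) : f.c v = (f.coeff v : WithTop ℝ) := by
  have : f.c v ≠ ⊤ := fun h => c_eq_top_iff.1 h hv
  lift f.c v to ℝ using this with r hr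
  rw [coeff, ← hr, WithTop.untopD_coe]

theorem term_eq_monomial (hv : v ∈ f.support) : f.term v x = (f.monomial v x : WithTop ℝ) := by
  rw [term, c_eq_coeff hv, monomial, WithTop.coe_add]

theorem term_eq_top (hv : v ∉ f.support) : f.term v x = ⊤ := by
  rw [term, c_eq_top_iff.2 hv, top_add]

theorem mem_closedRegion :
    x ∈ f.closedRegion v ↔ ∀ u ∈ f.support, f.monomial v x ≤ f.monomial u x := by
  simp only [closedRegion, carrier, Set.mem_ofPred_eq, Finset.mem_erase, normal_apply, monomial]
  constructor
  · intro h u hu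
    by_cases huv : u = v
    · rw [huv]
    · linarith [h u ⟨huv, hu⟩]
  · rintro h u ⟨-, hu⟩
    linarith [h u hu]

theorem monomial_add_smul (t : ℝ) : f.monomial v (x + t • y) =
    f.monomial v x + t * (toReal v ⬝ᵥ y) := by
  simp only [monomial, dotProduct_add, dotProduct_smul, smul_eq_mul]
  ring

theorem monomial_combo {s t : ℝ} (h : s + t = 1) : f.monomial v (s • x + t • y) =
    s * f.monomial v x + t * f.monomial v y := by
  simp only [monomial, dotProduct_add, dotProduct_smul, smul_eq_mul]
  linear_combination -f.coeff v * h

theorem continuous_monomial : Continuous (f.monomial v) := by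
  unfold monomial dotProduct
  fun_prop

theorem isOpen_openRegion : IsOpen (f.openRegion v) := by
  have : f.openRegion v = ⋂ u ∈ f.support.erase v, {x | f.monomial v x < f.monomial u x} := by
    ext x
    simp only [openRegion, Set.mem_ofPred_eq, Set.mem_iInter, Finset.mem_erase]
    exact ⟨fun h u hu => h u hu.2 hu.1, fun h u hu huv => h u ⟨huv, hu⟩⟩
  rw [this]
  exact isOpen_biInter_finset fun u _ => isOpen_lt continuous_monomial continuous_monomial

theorem convex_openRegion : Convex ℝ (f.openRegion v) := by
  intro x hx y hy s t hs ht hst u hu huv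
  rw [monomial_combo hst, monomial_combo hst]
  have h1 := hx u hu huv
  have h2 := hy u hu huv
  rcases hs.eq_or_lt with rfl | hs
  · obtain rfl : t = 1 := by linarith
    linarith
  · nlinarith

theorem disjoint_openRegion (hv : v ∈ f.support) (hw : w ∈ f.support) (h : v ≠ w) :
    Disjoint (f.openRegion v) (f.openRegion w) :=
  Set.disjoint_left.2 fun _ h1 h2 => lt_asymm (h1 w hw h.symm) (h2 v hv h)

/-- A segment from a point of the closed region to a point of the open one lies in the open region,
except perhaps for its starting point. -/
theorem closure_openRegion (hne : (f.openRegion v).Nonempty) :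
    closure (f.openRegion v) = f.closedRegion v := by
  apply Set.Subset.antisymm
  · refine closure_minimal (fun x hx => mem_closedRegion.2 fun u hu => ?_) isClosed_carrier
    by_cases huv : u = v
    · rw [huv]
    · exact (hx u hu huv).le
  · intro x hx
    rw [mem_closedRegion] at hx
    obtain ⟨z, hz⟩ := hne
    have hlim : Tendsto (fun t : ℝ => (1 - t) • x + t • z) (𝓝[>] 0) (𝓝 x) := by
      have : Continuous fun t : ℝ => (1 - t) • x + t • z := by fun_prop
      simpa using (this.tendsto 0).mono_left nhdsWithin_le_nhds
    refine mem_closure_of_tendsto hlim ?_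
    filter_upwards [Ioo_mem_nhdsGT (zero_lt_one' ℝ)] with t ht u hu huv
    rw [monomial_combo (by ring), monomial_combo (by ring)]
    have h1 := hx u hu
    have h2 := hz u hu huv
    nlinarith [ht.1, ht.2]

theorem compl_hypersurface : (f.hypersurface)ᶜ = ⋃ v ∈ f.support, f.openRegion v := by
  ext x
  simp only [Set.mem_compl_iff, Set.mem_iUnion, exists_prop, hypersurface, Set.mem_ofPred_eq]
  constructor
  · intro h
    have hne : f.support.Nonempty := by
      by_contra hemp
      rw [Finset.not_nonempty_iff_eq_empty] at hemp
      -- For the zero polynomial all terms tie at `∞`, so the hypersurface is all of space.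
      refine h ⟨0, 1, by simp, ?_⟩
      have : ∀ v, f.term v x = ⊤ := fun v => term_eq_top (by simp [hemp])
      simp [this]
    obtain ⟨v, hv, hmin⟩ := f.support.exists_min_image (fun v => f.monomial v x) hne
    refine ⟨v, hv, fun u hu huv => (hmin u hu).lt_of_ne fun heq => h ⟨v, u, huv.symm, ?_, ?_⟩⟩
    · rw [term_eq_monomial hv, term_eq_monomial hu, heq]
    · intro w
      by_cases hw : w ∈ f.support
      · rw [term_eq_monomial hv, term_eq_monomial hw]
        exact_mod_cast hmin w hw
      · rw [term_eq_top hw]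
        exact le_top
  · rintro ⟨v, hv, hx⟩ ⟨u, w, huw, heq, hmin⟩
    have key : ∀ u, f.term u x ≤ f.term v x → u = v := by
      intro u h
      by_contra huv
      by_cases hu : u ∈ f.support
      · rw [term_eq_monomial hv, term_eq_monomial hu, WithTop.coe_le_coe] at h
        exact h.not_gt (hx u hu huv)
      · rw [term_eq_monomial hv, term_eq_top hu, top_le_iff] at h
        exact WithTop.coe_ne_top h
    exact huw ((key u (hmin v)).trans (key w (heq ▸ hmin v)).symm)

/-- The open regions are convex, open and pairwise disjoint, so the nonempty ones are the components
of the complement. -/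
theorem mem_regions {R : Set (Fin 3 → ℝ)} : R ∈ f.regions ↔
    ∃ v ∈ f.support, (f.openRegion v).Nonempty ∧ R = f.closedRegion v := by
  have key : ∀ v ∈ f.support, ∀ x ∈ f.openRegion v,
      closure (connectedComponentIn (f.hypersurface)ᶜ x) = f.closedRegion v := by
    intro v hv x hx
    rw [← closure_openRegion ⟨x, hx⟩, connectedComponentIn_eq_of_disjoint_cover
      (V := ⋃ w ∈ f.support.erase v, f.openRegion w) isOpen_openRegion
      (isOpen_biUnion fun w _ => isOpen_openRegion) ?_ ?_ hx convex_openRegion.isPreconnected]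
    · rw [compl_hypersurface, ← Finset.set_biUnion_insert, Finset.insert_erase hv]
    · simp only [Set.disjoint_iUnion_right, Finset.mem_erase]
      exact fun w hw => disjoint_openRegion hv hw.2 hw.1.symm
  constructor
  · rintro ⟨x, hx, rfl⟩
    rw [compl_hypersurface] at hx
    simp only [Set.mem_iUnion, exists_prop] at hx
    obtain ⟨v, hv, hx⟩ := hx
    exact ⟨v, hv, ⟨x, hx⟩, key v hv x hx⟩
  · rintro ⟨v, hv, ⟨x, hx⟩, rfl⟩
    refine ⟨x, ?_, (key v hv x hx).symm⟩
    rw [compl_hypersurface]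
    exact Set.mem_biUnion hv hx

/-! ### Cells -/

/-- Duality: an affine function `a · v + b` below the lifted points is the same as the lower bound
`b` for the monomials at the point `-a`. -/
theorem mem_regularSubdivision {S : Finset (Fin 3 → ℤ)} : S ∈ f.regularSubdivision ↔
    ∃ (x : Fin 3 → ℝ) (m : ℝ), (∀ v ∈ f.support, m ≤ f.monomial v x) ∧
      ∀ v, v ∈ S ↔ v ∈ f.support ∧ f.monomial v x = m := by
  have hle : ∀ (a : Fin 3 → ℝ) (b : ℝ), (∀ v, ((a ⬝ᵥ toReal v + b : ℝ) : WithTop ℝ) ≤ f.c v) ↔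
      ∀ v ∈ f.support, b ≤ f.monomial v (-a) := by
    intro a b
    refine forall_congr' fun v => ?_
    by_cases hv : v ∈ f.support
    · rw [c_eq_coeff hv, WithTop.coe_le_coe, monomial, dotProduct_neg, dotProduct_comm a]
      simp only [hv, true_imp_iff]
      constructor <;> intro h <;> linarith
    · simp [c_eq_top_iff.2 hv, hv]
  have heq : ∀ (a : Fin 3 → ℝ) (b : ℝ) (v), ((a ⬝ᵥ toReal v + b : ℝ) : WithTop ℝ) = f.c v ↔
      v ∈ f.support ∧ f.monomial v (-a) = b := by
    intro a b v
    by_cases hv : v ∈ f.support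
    · rw [c_eq_coeff hv, WithTop.coe_inj, monomial, dotProduct_neg, dotProduct_comm a]
      simp only [hv, true_and]
      constructor <;> intro h <;> linarith
    · simp [c_eq_top_iff.2 hv, hv]
  simp only [regularSubdivision, Set.mem_ofPred_eq, hle, heq]
  constructor
  · rintro ⟨a, b, h1, h2⟩
    exact ⟨-a, b, h1, h2⟩
  · rintro ⟨x, m, h1, h2⟩
    exact ⟨-x, m, by rwa [neg_neg], by rwa [neg_neg]⟩

theorem subset_support {S : Finset (Fin 3 → ℤ)} (hS : S ∈ f.regularSubdivision) :
    S ⊆ f.support := by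
  obtain ⟨x, m, -, h⟩ := mem_regularSubdivision.1 hS
  exact fun v hv => ((h v).1 hv).1

theorem finite_regularSubdivision : f.regularSubdivision.Finite :=
  f.support.powerset.finite_toSet.subset fun _ hS => Finset.mem_powerset.2 (subset_support hS)

theorem exists_maximal {S : Finset (Fin 3 → ℤ)} (hS : S ∈ f.regularSubdivision) :
    ∃ M, S ⊆ M ∧ Maximal (· ∈ f.regularSubdivision) M :=
  finite_regularSubdivision.exists_le_maximal hS

theorem empty_mem_regularSubdivision : ∅ ∈ f.regularSubdivision := by
  obtain ⟨m, hm⟩ := (f.support.image fun v => -f.monomial v 0).exists_le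
  -- A level strictly below all monomials at `0`, touching none.
  refine mem_regularSubdivision.2 ⟨0, -m - 1, fun v hv => ?_, fun v => ?_⟩
  · linarith [hm _ (Finset.mem_image_of_mem _ hv)]
  · simp only [Finset.notMem_empty, false_iff, not_and]
    intro hv
    linarith [hm _ (Finset.mem_image_of_mem _ hv)]

theorem openRegion_nonempty (h : {v} ∈ f.regularSubdivision) : (f.openRegion v).Nonempty := by
  obtain ⟨x, m, h1, h2⟩ := mem_regularSubdivision.1 h
  refine ⟨x, fun u hu huv => ?_⟩
  rw [((h2 v).1 (Finset.mem_singleton_self v)).2]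
  refine (h1 u hu).lt_of_ne' fun h => huv ?_
  simpa using (h2 u).2 ⟨hu, h⟩

/-- The active sets of the region of `v` are the links of `v` in the cells. -/
theorem mem_activeSets_iff (hv : v ∈ f.support) {A : Finset (Fin 3 → ℤ)} :
    A ∈ activeSets (f.support.erase v) (normal v) (fun u => f.coeff u - f.coeff v) ↔
      v ∉ A ∧ insert v A ∈ f.regularSubdivision := by
  have hact : ∀ x u, u ∈ active (f.support.erase v) (normal v)
      (fun u => f.coeff u - f.coeff v) x ↔
        u ≠ v ∧ u ∈ f.support ∧ f.monomial u x = f.monomial v x := by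
    intro x u
    rw [mem_active, Finset.mem_erase, normal_apply, and_assoc, monomial, monomial]
    refine and_congr_right fun _ => and_congr_right fun _ => ?_
    constructor <;> intro h <;> linarith
  rw [mem_activeSets]
  constructor
  · rintro ⟨x, hx, rfl⟩
    refine ⟨fun h => ((hact x v).1 h).1 rfl,
      mem_regularSubdivision.2 ⟨x, f.monomial v x, mem_closedRegion.1 hx, fun u => ?_⟩⟩
    rw [Finset.mem_insert, hact]
    by_cases huv : u = v
    · simp [huv, hv]
    · simp [huv]
  · rintro ⟨hvA, hA⟩
    obtain ⟨x, m, h1, h2⟩ := mem_regularSubdivision.1 hA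
    obtain ⟨-, rfl⟩ := (h2 v).1 (Finset.mem_insert_self v A)
    refine ⟨x, mem_closedRegion.2 h1, Finset.ext fun u => ?_⟩
    rw [hact, ← h2, Finset.mem_insert]
    by_cases huv : u = v
    · simp [huv, hvA]
    · simp [huv]

/-! ### Unimodular triangulations -/

/-- Four dependent points lie in a proper affine subspace, which is null. -/
theorem affineIndependent_of_volume_ne_zero {M : Finset (Fin 3 → ℤ)} (hM : M.card = 4)
    (hvol : normalizedVolume (latticeHull M) ≠ 0) :
    AffineIndependent ℝ fun v : M => toReal v := by
  rw [affineIndependent_iff_finrank_vectorSpan_eq ℝ _ (n := 3) (by simpa using hM)]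
  have hr : Set.range (fun v : M => toReal v) = toReal '' (M : Set (Fin 3 → ℤ)) := by
    rw [Set.image_eq_range]; rfl
  rw [hr]
  by_contra hne
  have htop : affineSpan ℝ (toReal '' (M : Set (Fin 3 → ℤ))) ≠ ⊤ := by
    intro h
    apply hne
    rw [← direction_affineSpan, h, AffineSubspace.direction_top, finrank_top]
    simp
  apply hvol
  have h0 := MeasureTheory.Measure.addHaar_affineSubspace MeasureTheory.volume _ htop
  have h1 := MeasureTheory.measure_mono_null
    (convexHull_subset_affineSpan (𝕜 := ℝ) (toReal '' (M : Set (Fin 3 → ℤ)))) h0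
  rw [normalizedVolume, latticeHull, MeasureTheory.measureReal_def, h1]
  simp

theorem linearIndepOn_normal {M : Finset (Fin 3 → ℤ)}
    (hM : AffineIndependent ℝ fun v : M => toReal v) (hv : v ∈ M) :
    LinearIndepOn ℝ (normal v) (M.erase v : Set (Fin 3 → ℤ)) := by
  rw [affineIndependent_iff_linearIndependent_vsub ℝ _ ⟨v, hv⟩] at hM
  have hinj : Function.Injective fun u : (M.erase v : Set (Fin 3 → ℤ)) =>
      (⟨⟨u, Finset.mem_of_mem_erase u.2⟩, fun h =>
        Finset.ne_of_mem_erase u.2 (congrArg Subtype.val h)⟩ : {u : M // u ≠ ⟨v, hv⟩}) := by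
    intro a b h
    simp only [Subtype.mk.injEq] at h
    exact Subtype.ext h
  have h := (hM.comp _ hinj).map' ((LinearEquiv.neg ℝ).trans (dotProductEquiv ℝ (Fin 3))).toLinearMap
    (LinearEquiv.ker _)
  have e : (fun u : (M.erase v : Set (Fin 3 → ℤ)) => normal v u) =
      fun u : (M.erase v : Set (Fin 3 → ℤ)) =>
        (LinearEquiv.neg ℝ).trans (dotProductEquiv ℝ (Fin 3)) (toReal u - toReal v) :=
    funext fun u => by simp [normal]
  rw [LinearIndepOn, e]
  exact h

/-- An active set together with `v` is a cell, hence part of a tetrahedron, whose edge vectors at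
`v` are independent. -/
theorem IsSmooth.isSimple (hf : f.IsSmooth) (hv : v ∈ f.support) :
    IsSimple (f.support.erase v) (normal v) (fun u => f.coeff u - f.coeff v) := by
  intro A hA
  obtain ⟨hvA, hA⟩ := (mem_activeSets_iff hv).1 hA
  obtain ⟨M, hAM, hM⟩ := exists_maximal hA
  obtain ⟨hcard, hvol⟩ := hf M hM
  refine (linearIndepOn_normal (affineIndependent_of_volume_ne_zero hcard (by rw [hvol]; simp))
    (hAM (Finset.mem_insert_self v A))).mono fun u hu => ?_
  refine Finset.mem_erase.2 ⟨fun h => hvA (h ▸ hu), hAM (Finset.mem_insert_of_mem hu)⟩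

theorem IsSmooth.maximal_iff (hf : f.IsSmooth) {M : Finset (Fin 3 → ℤ)} :
    Maximal (· ∈ f.regularSubdivision) M ↔ M ∈ f.regularSubdivision ∧ M.card = 4 := by
  refine ⟨fun h => ⟨h.1, (hf M h).1⟩, fun ⟨h, hc⟩ => ?_⟩
  obtain ⟨N, hMN, hN⟩ := exists_maximal h
  rwa [Finset.eq_of_subset_of_card_le hMN ((hf N hN).1.trans hc.symm).le]

end

end TropPoly

end K3

/-! ### Bounded regions -/

namespace K3.TropPoly

open Module Polyhedron Filter Topology

variable {f : TropPoly} {v : Fin 3 → ℤ}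

theorem convex_newton : Convex ℝ f.newton := convex_convexHull _ _

theorem toReal_mem_newton (hv : v ∈ f.support) : toReal v ∈ f.newton :=
  subset_convexHull _ _ ⟨v, hv, rfl⟩

theorem forall_mem_newton {l : (Fin 3 → ℝ) →ₗ[ℝ] ℝ} {r : ℝ}
    (h : ∀ v ∈ f.support, l (toReal v) ≤ r) : ∀ q ∈ f.newton, l q ≤ r := by
  refine fun q hq => convexHull_min (t := {q | l q ≤ r}) ?_ (convex_halfSpace_le l.isLinear r) hq
  rintro _ ⟨v, hv, rfl⟩
  exact h v hv

theorem exists_forall_sub_single_mem {P : Set (Fin 3 → ℝ)} {x : Fin 3 → ℝ} (hx : x ∈ interior P) :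
    ∃ ε > 0, ∀ (i : Fin 3) (r : ℝ), |r| ≤ ε → x - Pi.single i r ∈ P := by
  obtain ⟨ε, hε, hball⟩ := Metric.mem_nhds_iff.1 (mem_interior_iff_mem_nhds.1 hx)
  refine ⟨ε / 2, half_pos hε, fun i r hr => hball ?_⟩
  rw [Metric.mem_ball, dist_eq_norm, sub_sub_cancel_left, norm_neg, Pi.norm_single,
    Real.norm_eq_abs]
  linarith

/-- For `y` in the region, minimality of `v` bounds `(v - q) · y` uniformly for `q` in the Newton
polytope. Taking `q = v ± ε eᵢ` bounds each coordinate of `y`. -/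
theorem isBounded_closedRegion (hv : toReal v ∈ interior f.newton) :
    Bornology.IsBounded (f.closedRegion v) := by
  obtain ⟨ε, hε, hmem⟩ := exists_forall_sub_single_mem hv
  obtain ⟨C, hC⟩ := (f.support.image fun u => f.coeff u - f.coeff v).exists_le
  refine isBounded_iff_forall_norm_le.2 ⟨|C| / ε, fun y hy => ?_⟩
  rw [mem_closedRegion] at hy
  have hP : ∀ q ∈ f.newton, dotProductEquiv ℝ (Fin 3) (-y) q ≤ C - toReal v ⬝ᵥ y :=
    forall_mem_newton fun u hu => by
      have h1 := hy u hu
      have h2 := hC _ (Finset.mem_image_of_mem _ hu)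
      rw [dotProductEquiv_apply_apply, neg_dotProduct, dotProduct_comm]
      unfold monomial at h1
      linarith
  have hi : ∀ i r, |r| ≤ ε → r * y i ≤ C := by
    intro i r hr
    have := hP _ (hmem i r hr)
    rw [dotProductEquiv_apply_apply, neg_dotProduct, dotProduct_sub, dotProduct_single,
      dotProduct_comm y] at this
    linarith
  rw [pi_norm_le_iff_of_nonneg (by positivity)]
  intro i
  rw [Real.norm_eq_abs, le_div_iff₀ hε]
  refine le_trans ?_ (le_abs_self C)
  rcases abs_cases (y i) with ⟨h, -⟩ | ⟨h, -⟩ <;> rw [h]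
  · linarith [hi i ε (abs_of_pos hε).le]
  · linarith [hi i (-ε) (by rw [abs_neg, abs_of_pos hε])]

/-- Otherwise a functional supports the Newton polytope at `v`, and the region contains a ray in the
opposite direction. -/
theorem mem_interior_newton_of_isBounded (hne : (f.closedRegion v).Nonempty)
    (hb : Bornology.IsBounded (f.closedRegion v)) (hP : (interior f.newton).Nonempty) :
    toReal v ∈ interior f.newton := by
  by_contra hnot
  obtain ⟨l, hl⟩ := geometric_hahn_banach_open_point convex_newton.interior isOpen_interior hnot
  have hle : ∀ u ∈ f.support, l (toReal u) ≤ l (toReal v) := by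
    intro u hu
    have h1 : toReal u ∈ closure (interior f.newton) := by
      rw [convex_newton.closure_interior_eq_closure_of_nonempty_interior hP]
      exact subset_closure (toReal_mem_newton hu)
    exact closure_minimal (t := {x | l x ≤ l (toReal v)}) (fun x hx => (hl x hx).le)
      (isClosed_le l.continuous continuous_const) h1
  obtain ⟨y, hy⟩ := hne
  set d := (dotProductEquiv ℝ (Fin 3)).symm l.toLinearMap
  have hd : ∀ x, x ⬝ᵥ d = l x := by
    intro x
    rw [dotProduct_comm, ← dotProductEquiv_apply_apply, LinearEquiv.apply_symm_apply]
    rfl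
  have hd0 : d ≠ 0 := by
    intro h0
    obtain ⟨x, hx⟩ := hP
    have := hl x hx
    rw [← hd, ← hd, h0, dotProduct_zero, dotProduct_zero] at this
    exact lt_irrefl _ this
  have hray : ∀ t : ℝ, 0 ≤ t → y + (-t) • d ∈ f.closedRegion v := by
    intro t ht
    rw [mem_closedRegion] at hy ⊢
    intro u hu
    rw [monomial_add_smul, monomial_add_smul, hd, hd]
    have := mul_le_mul_of_nonneg_left (hle u hu) ht
    linarith [hy u hu]
  obtain ⟨C, hC⟩ := isBounded_iff_forall_norm_le.1 hb
  have hdn : 0 < ‖d‖ := norm_pos_iff.2 hd0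
  have hC0 : 0 ≤ C := (norm_nonneg y).trans (hC y hy)
  have h1 := hC _ (hray ((C + ‖y‖ + 1) / ‖d‖) (by positivity))
  have h2 : ‖-((C + ‖y‖ + 1) / ‖d‖) • d‖ = C + ‖y‖ + 1 := by
    rw [norm_smul, norm_neg, Real.norm_of_nonneg (by positivity), div_mul_cancel₀ _ hdn.ne']
  have h3 := norm_sub_le (y + -((C + ‖y‖ + 1) / ‖d‖) • d) y
  rw [add_sub_cancel_left, h2] at h3
  linarith

/-! ### Covering the Newton polytope by the cells -/

/-- The concave function `φ y = min_v (c_v + v · y) - x · y` tends to `-∞` because `x` is interior,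
so it has a maximizer `y`. The exponents minimal at `y` form the cell: were `x` outside their hull,
moving `y` along a separating direction would increase `φ`. -/
theorem exists_cell_of_mem_interior {x : Fin 3 → ℝ} (hx : x ∈ interior f.newton) :
    ∃ S ∈ f.regularSubdivision, x ∈ latticeHull S := by
  have hne : f.support.Nonempty := by
    by_contra h
    rw [Finset.not_nonempty_iff_eq_empty] at h
    simp [newton, latticeHull, h] at hx
  set φ : (Fin 3 → ℝ) → ℝ := fun y => f.support.inf' hne fun v => f.monomial v y - x ⬝ᵥ y
  have hφ : ∀ y, ∀ v ∈ f.support, φ y ≤ f.monomial v y - x ⬝ᵥ y := fun y v hv =>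
    Finset.inf'_le (fun v => f.monomial v y - x ⬝ᵥ y) hv
  have hcont : Continuous φ := by
    refine Continuous.finset_inf'_apply hne fun v _ => continuous_monomial.sub ?_
    unfold dotProduct
    fun_prop
  obtain ⟨ε, hε, hmem⟩ := exists_forall_sub_single_mem hx
  obtain ⟨C, hC⟩ := (f.support.image f.coeff).exists_le
  have hbound : ∀ y, φ y ≤ C - ε * ‖y‖ := by
    intro y
    have hP : ∀ q ∈ f.newton, dotProductEquiv ℝ (Fin 3) (-y) q ≤ C - x ⬝ᵥ y - φ y :=
      forall_mem_newton fun u hu => by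
        have h1 := hφ y u hu
        have h2 := hC _ (Finset.mem_image_of_mem _ hu)
        rw [dotProductEquiv_apply_apply, neg_dotProduct, dotProduct_comm]
        unfold monomial at h1
        linarith
    have hi : ∀ i r, |r| ≤ ε → r * y i ≤ C - φ y := by
      intro i r hr
      have := hP _ (hmem i r hr)
      rw [dotProductEquiv_apply_apply, neg_dotProduct, dotProduct_sub, dotProduct_single,
        dotProduct_comm y] at this
      linarith
    have h0 : 0 ≤ C - φ y := by simpa using hi 0 0 (by simpa using hε.le)
    have : ‖y‖ ≤ (C - φ y) / ε := by
      rw [pi_norm_le_iff_of_nonneg (by positivity)]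
      intro i
      rw [Real.norm_eq_abs, le_div_iff₀ hε]
      rcases abs_cases (y i) with ⟨h, -⟩ | ⟨h, -⟩ <;> rw [h]
      · linarith [hi i ε (abs_of_pos hε).le]
      · linarith [hi i (-ε) (by rw [abs_neg, abs_of_pos hε])]
    rw [le_div_iff₀ hε] at this
    linarith
  have hlim : Tendsto φ (cocompact (Fin 3 → ℝ)) atBot := by
    refine tendsto_atBot_mono hbound ?_
    exact tendsto_atBot_add_const_left _ C
      (tendsto_neg_atTop_atBot.comp (tendsto_norm_cocompact_atTop.const_mul_atTop hε))
  obtain ⟨y, hy⟩ := hcont.exists_forall_ge hlim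
  set S := f.support.filter fun v => f.monomial v y = φ y + x ⬝ᵥ y
  have hmemS : ∀ v, v ∈ S ↔ v ∈ f.support ∧ f.monomial v y = φ y + x ⬝ᵥ y := fun v =>
    Finset.mem_filter
  refine ⟨S, mem_regularSubdivision.2 ⟨y, φ y + x ⬝ᵥ y, fun v hv => ?_, hmemS⟩, ?_⟩
  · linarith [hφ y v hv]
  by_contra hnot
  have hK : IsClosed (latticeHull S) :=
    ((S.finite_toSet.image toReal).isCompact_convexHull ℝ).isClosed
  obtain ⟨l, r, h1, h2⟩ := geometric_hahn_banach_point_closed (convex_convexHull ℝ _) hK hnot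
  set d := (dotProductEquiv ℝ (Fin 3)).symm l.toLinearMap
  have hd : ∀ x, x ⬝ᵥ d = l x := by
    intro x
    rw [dotProduct_comm, ← dotProductEquiv_apply_apply, LinearEquiv.apply_symm_apply]
    rfl
  have hev : ∀ᶠ t in 𝓝[>] (0 : ℝ), ∀ v ∈ f.support,
      φ y < f.monomial v (y + t • d) - x ⬝ᵥ (y + t • d) := by
    rw [Filter.eventually_all_finset]
    intro v hv
    have hval : ∀ t : ℝ, f.monomial v (y + t • d) - x ⬝ᵥ (y + t • d) =
        f.monomial v y - x ⬝ᵥ y + t * (l (toReal v) - l x) := by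
      intro t
      rw [monomial_add_smul, dotProduct_add, dotProduct_smul, hd, hd, smul_eq_mul]
      ring
    simp only [hval]
    by_cases hvS : v ∈ S
    · filter_upwards [self_mem_nhdsWithin] with t ht
      have ht : 0 < t := ht
      have h3 := h2 _ (subset_convexHull ℝ _ ⟨v, hvS, rfl⟩)
      have h4 := ((hmemS v).1 hvS).2
      have := mul_pos ht (sub_pos.2 (h1.trans h3))
      linarith
    · have hlt : φ y < f.monomial v y - x ⬝ᵥ y := by
        refine (hφ y v hv).lt_of_ne fun h => hvS ((hmemS v).2 ⟨hv, by linarith⟩)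
      have hc : ContinuousAt (fun t : ℝ =>
          f.monomial v y - x ⬝ᵥ y + t * (l (toReal v) - l x)) 0 := by fun_prop
      exact nhdsWithin_le_nhds (continuousAt_const.eventually_lt hc (by simpa using hlt))
  obtain ⟨t, ht⟩ := hev.exists
  exact (hy (y + t • d)).not_gt ((Finset.lt_inf'_iff hne).2 ht)

/-- If the cells are dual to `(y, m)` and `(z, n)`, then `(y - z) · q ≤ m - n` on one hull and `≥`
on the other. The intersection lies in a hyperplane, unless `y = z`, when a common point gives `m =
n` and the cells coincide. -/
theorem volume_inter_latticeHull {M N : Finset (Fin 3 → ℤ)} (hM : M ∈ f.regularSubdivision)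
    (hN : N ∈ f.regularSubdivision) (hMN : M ≠ N) :
    MeasureTheory.volume (latticeHull M ∩ latticeHull N) = 0 := by
  obtain ⟨y, m, hy, hyM⟩ := mem_regularSubdivision.1 hM
  obtain ⟨z, n, hz, hzN⟩ := mem_regularSubdivision.1 hN
  have key : ∀ {M : Finset (Fin 3 → ℤ)} {y z : Fin 3 → ℝ} {m n : ℝ},
      (∀ v, v ∈ M ↔ v ∈ f.support ∧ f.monomial v y = m) → (∀ v ∈ f.support, n ≤ f.monomial v z) →
      ∀ q ∈ latticeHull M, dotProductEquiv ℝ (Fin 3) (y - z) q ≤ m - n := by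
    intro M y z m n hyM hz q hq
    refine convexHull_min (t := {q | dotProductEquiv ℝ (Fin 3) (y - z) q ≤ m - n}) ?_
      (convex_halfSpace_le (LinearMap.isLinear _) _) hq
    rintro _ ⟨v, hv, rfl⟩
    have h1 := (hyM v).1 hv
    have h2 := hz v h1.1
    have h3 := h1.2
    rw [Set.mem_ofPred_eq, dotProductEquiv_apply_apply, dotProduct_comm, dotProduct_sub]
    unfold monomial at h2 h3
    linarith
  have hsub : ∀ q ∈ latticeHull M ∩ latticeHull N,
      dotProductEquiv ℝ (Fin 3) (y - z) q = m - n := by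
    intro q hq
    have h1 := key hyM hz q hq.1
    have h2 := key hzN hy q hq.2
    rw [← neg_sub y z, map_neg, LinearMap.neg_apply] at h2
    linarith
  rcases (latticeHull M ∩ latticeHull N).eq_empty_or_nonempty with h | ⟨q, hq⟩
  · rw [h, MeasureTheory.measure_empty]
  by_cases hyz : y = z
  · subst hyz
    have h1 := hsub q hq
    rw [sub_self, map_zero, LinearMap.zero_apply] at h1
    obtain rfl : m = n := by linarith
    exact absurd (Finset.ext fun v => (hyM v).trans (hzN v).symm) hMN
  · refine MeasureTheory.measure_mono_null (t := (AffineSubspace.mk' q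
      (LinearMap.ker (dotProductEquiv ℝ (Fin 3) (y - z))) : Set (Fin 3 → ℝ))) ?_
      (MeasureTheory.Measure.addHaar_affineSubspace _ _ ?_)
    · intro p hp
      rw [SetLike.mem_coe, AffineSubspace.mem_mk', LinearMap.mem_ker, vsub_eq_sub, map_sub,
        hsub p hp, hsub q hq, sub_self]
    · intro h
      have h2 := congrArg AffineSubspace.direction h
      rw [AffineSubspace.direction_mk', AffineSubspace.direction_top, LinearMap.ker_eq_top,
        LinearEquiv.map_eq_zero_iff, sub_eq_zero] at h2
      exact hyz h2

/-- The volume of the Newton polytope is the number of tetrahedra of the triangulation. -/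
theorem IsSmooth.normalizedVolume_newton (hf : f.IsSmooth) :
    normalizedVolume f.newton = {M | Maximal (· ∈ f.regularSubdivision) M}.ncard := by
  have hfin : {M | Maximal (· ∈ f.regularSubdivision) M}.Finite :=
    finite_regularSubdivision.subset fun M hM => hM.1
  have hmem : ∀ M, M ∈ hfin.toFinset ↔ Maximal (· ∈ f.regularSubdivision) M := fun M => by simp
  have hcompact : ∀ M : Finset (Fin 3 → ℤ), IsCompact (latticeHull M) := fun M =>
    (M.finite_toSet.image toReal).isCompact_convexHull ℝ
  have h1 : MeasureTheory.volume f.newton =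
      MeasureTheory.volume (⋃ M ∈ hfin.toFinset, latticeHull M) := by
    apply le_antisymm
    -- The frontier of a convex set is null, so covering the interior is enough.
    · rw [← MeasureTheory.measure_congr (interior_ae_eq_of_null_frontier
        (convex_newton.addHaar_frontier MeasureTheory.volume))]
      refine MeasureTheory.measure_mono fun x hx => ?_
      obtain ⟨S, hS, hxS⟩ := exists_cell_of_mem_interior hx
      obtain ⟨M, hSM, hM⟩ := exists_maximal hS
      exact Set.mem_biUnion ((hmem M).2 hM)
        (convexHull_mono (Set.image_mono (Finset.coe_subset.2 hSM)) hxS)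
    · refine MeasureTheory.measure_mono (Set.iUnion₂_subset fun M hM => ?_)
      exact convexHull_mono (Set.image_mono
        (Finset.coe_subset.2 (subset_support ((hmem M).1 hM).1)))
  rw [MeasureTheory.measure_biUnion_finset₀
    (fun M hM N hN hMN => volume_inter_latticeHull ((hmem M).1 hM).1 ((hmem N).1 hN).1 hMN)
    fun M _ => (hcompact M).measurableSet.nullMeasurableSet] at h1
  rw [normalizedVolume, MeasureTheory.measureReal_def, h1,
    ENNReal.toReal_sum fun M _ => (hcompact M).measure_lt_top.ne, Finset.mul_sum,
    Set.ncard_eq_toFinset_card _ hfin, Finset.card_eq_sum_ones, Nat.cast_sum]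
  refine Finset.sum_congr rfl fun M hM => ?_
  rw [Nat.cast_one, ← (hf M ((hmem M).1 hM)).2]
  rfl

end K3.TropPoly

/-! ### Face numbers of the bounded region -/

namespace K3.TropPoly

open Module Polyhedron

variable {f : TropPoly} {v : Fin 3 → ℤ}

theorem IsSmooth.fNumber_closedRegion (hf : f.IsSmooth) (hv : v ∈ f.support) (k : ℕ) :
    fNumber (f.closedRegion v) k = ((activeSets (f.support.erase v) (normal v)
      fun u => f.coeff u - f.coeff v).filter fun A => A.card + k = 3).card := by
  have := ncard_setOf_isExposed (hf.isSimple hv) k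
  rw [finrank_fin_fun] at this
  exact this

theorem IsSmooth.finite_faces_closedRegion (hf : f.IsSmooth) (hv : v ∈ f.support) (k : ℕ) :
    (faces (f.closedRegion v) k).Finite := by
  have := setOf_isExposed_eq_image (hf.isSimple hv) k
  exact Set.Finite.subset ((Finset.finite_toSet _).image _) this.subset

theorem IsSmooth.fNumber_relations (hf : f.IsSmooth) (hv : v ∈ f.support)
    (hne : (f.closedRegion v).Nonempty) (hb : Bornology.IsBounded (f.closedRegion v)) :
    2 * fNumber (f.closedRegion v) 1 = 3 * fNumber (f.closedRegion v) 0 ∧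
      2 * fNumber (f.closedRegion v) 2 = fNumber (f.closedRegion v) 0 + 4 :=
  card_activeSets_of_finrank_eq_three (hf.isSimple hv) hb hne (finrank_fin_fun ℝ)
    (hf.fNumber_closedRegion hv)

theorem IsSmooth.dim_closedRegion (hf : f.IsSmooth) (hv : v ∈ f.support)
    (hne : (f.closedRegion v).Nonempty) : dim (f.closedRegion v) = 3 := by
  obtain ⟨x, hx⟩ := hne
  have h := finrank_vectorSpan_face_add_card (hf.isSimple hv) (mem_activeSets_of_subset
    (hf.isSimple hv) (active_mem_activeSets hx) (Finset.empty_subset _))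
  rw [finrank_fin_fun, Finset.card_empty, add_zero, face_empty] at h
  exact h

/-- By centrality a maximal cell contains `v`; removing `v` leaves the active set of a vertex, and
inserting it is the inverse. -/
theorem IsSmooth.fNumber_zero_eq_ncard (hf : f.IsSmooth) (hv : v ∈ f.support)
    (hc : IsCentral f.regularSubdivision v) :
    fNumber (f.closedRegion v) 0 = {M | Maximal (· ∈ f.regularSubdivision) M}.ncard := by
  rw [hf.fNumber_closedRegion hv, ← Set.ncard_coe_finset]
  have hmax : ∀ M, Maximal (· ∈ f.regularSubdivision) M → v ∈ M := by
    intro M hM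
    have h : M ∈ centralPart f.regularSubdivision v := by
      rw [hc]; exact hM.1
    exact hM.2 h.2 (Finset.subset_insert v M) (Finset.mem_insert_self v M)
  refine Set.BijOn.ncard_eq (f := fun A => insert v A) ⟨?_, ?_, ?_⟩
  · intro A hA
    rw [Finset.mem_coe, Finset.mem_filter, mem_activeSets_iff hv] at hA
    refine hf.maximal_iff.2 ⟨hA.1.2, ?_⟩
    rw [Finset.card_insert_of_notMem hA.1.1]
    omega
  · intro A hA B hB h
    rw [Finset.mem_coe, Finset.mem_filter, mem_activeSets_iff hv] at hA hB
    rw [← Finset.erase_insert hA.1.1, ← Finset.erase_insert hB.1.1]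
    exact congrArg (·.erase v) h
  · intro M hM
    have hvM := hmax M hM
    refine ⟨M.erase v, ?_, Finset.insert_erase hvM⟩
    rw [Finset.mem_coe, Finset.mem_filter, mem_activeSets_iff hv, Finset.insert_erase hvM,
      Finset.card_erase_of_mem hvM, (hf.maximal_iff.1 hM).2]
    exact ⟨⟨Finset.notMem_erase _ _, hM.1⟩, rfl⟩

theorem isQuartic_of_newton_subset (h : f.newton ⊆ fourSimplex) : f.IsQuartic := by
  intro v hv
  have hv' : toReal v ∈ fourSimplex := h (toReal_mem_newton hv)
  have hle : ∀ (l : Dual ℝ (Fin 3 → ℝ)) (r : ℝ), 0 ≤ r → l ![4, 0, 0] ≤ r → l ![0, 4, 0] ≤ r →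
      l ![0, 0, 4] ≤ r → l (toReal v) ≤ r := by
    intro l r h0 h1 h2 h3
    refine convexHull_min (t := {q | l q ≤ r}) ?_ (convex_halfSpace_le l.isLinear r) hv'
    have hz : (![0, 0, 0] : Fin 3 → ℝ) = 0 := by ext i; fin_cases i <;> rfl
    rintro q (rfl | rfl | rfl | rfl)
    · rw [Set.mem_ofPred_eq, hz, map_zero]
      exact h0
    all_goals assumption
  constructor
  · intro i
    have := hle (-LinearMap.proj i) 0 le_rfl (by fin_cases i <;> simp) (by fin_cases i <;> simp)
      (by fin_cases i <;> simp)
    simpa [toReal] using this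
  · have := hle (∑ i, LinearMap.proj i) 4 (by norm_num) (by simp [Fin.sum_univ_three])
      (by simp [Fin.sum_univ_three]) (by simp [Fin.sum_univ_three])
    simp only [LinearMap.sum_apply, LinearMap.proj_apply, toReal] at this
    exact_mod_cast this

end K3.TropPoly

/-! ### Both parts of the lemma -/

theorem mainTheorem4 :
    (∀ (P : Set (Fin 3 → ℝ)) (p : Fin 3 → ℤ), K3.IsReflexive P p → P ⊆ K3.fourSimplex →
      ∀ (T : Set (Finset (Fin 3 → ℤ))) (f : K3.TropPoly),
        f.newton = P → f.regularSubdivision = T →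
        K3.IsUnimodularTriangulation T → K3.IsCentral T p →
        ∃ Q : Set (Fin 3 → ℝ), f.IsBoundedRegion Q ∧ K3.IsK3Polytope Q ∧
          K3.IsPolytope Q ∧ K3.dim Q = 3 ∧
          (K3.fNumber Q 0 : ℝ) = K3.normalizedVolume P ∧
          (K3.fNumber Q 1 : ℝ) = 3 / 2 * K3.normalizedVolume P ∧
          (K3.fNumber Q 2 : ℝ) = 1 / 2 * K3.normalizedVolume P + 2) ∧
    (∀ Q : Set (Fin 3 → ℝ), K3.IsK3Polytope Q →
      (K3.faces Q 0).Finite ∧ Even (K3.fNumber Q 0)) := by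
  open K3 K3.TropPoly in
  constructor
  · rintro _ p hP hsub _ f rfl rfl hf hc
    change f.IsSmooth at hf
    -- Centrality applied to the empty cell makes `p` a vertex of the triangulation, so its open
    -- region is nonempty.
    have hpT : {p} ∈ f.regularSubdivision := by
      have h : ∅ ∈ centralPart f.regularSubdivision p := by
        rw [hc]; exact empty_mem_regularSubdivision
      exact h.2
    have hp : p ∈ f.support := subset_support hpT (Finset.mem_singleton_self p)
    have hint : toReal p ∈ interior f.newton := (hP.interior_iff p).2 rfl
    have hopen := openRegion_nonempty hpT
    have hne : (f.closedRegion p).Nonempty := by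
      rw [← closure_openRegion hopen]
      exact hopen.closure
    have hb := isBounded_closedRegion hint
    have hregion : f.IsBoundedRegion (f.closedRegion p) := by
      refine ⟨mem_regions.2 ⟨p, hp, hopen, rfl⟩, hb, fun R hR hRb => ?_⟩
      obtain ⟨v, -, hvo, rfl⟩ := mem_regions.1 hR
      have hvne : (f.closedRegion v).Nonempty := by
        rw [← closure_openRegion hvo]
        exact hvo.closure
      rw [(hP.interior_iff v).1 (mem_interior_newton_of_isBounded hvne hRb ⟨_, hint⟩)]
    have h0 : (fNumber (f.closedRegion p) 0 : ℝ) = normalizedVolume f.newton := by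
      rw [hf.normalizedVolume_newton, hf.fNumber_zero_eq_ncard hp hc]
    obtain ⟨h1, h2⟩ := hf.fNumber_relations hp hne hb
    have h1' : (2 : ℝ) * fNumber (f.closedRegion p) 1 = 3 * fNumber (f.closedRegion p) 0 := by
      exact_mod_cast h1
    have h2' : (2 : ℝ) * fNumber (f.closedRegion p) 2 = fNumber (f.closedRegion p) 0 + 4 := by
      exact_mod_cast h2
    exact ⟨f.closedRegion p, hregion, ⟨f, isQuartic_of_newton_subset hsub, hf, hregion⟩,
      Polyhedron.exists_finset_eq_convexHull (hf.isSimple hp) hb, hf.dim_closedRegion hp hne, h0,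
      by linarith, by linarith⟩
  · rintro Q ⟨f, -, hf, hQ, hb, -⟩
    obtain ⟨v, hv, hvo, rfl⟩ := mem_regions.1 hQ
    have hvne : (f.closedRegion v).Nonempty := by
      rw [← closure_openRegion hvo]
      exact hvo.closure
    refine ⟨hf.finite_faces_closedRegion hv 0, ?_⟩
    obtain ⟨h1, -⟩ := hf.fNumber_relations hv hvne hb
    rw [even_iff_two_dvd]
    -- Here `3 f₀ = 2 f₁`, so `f₀` is even.
    omega
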